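/- Let $k\ge 0$, $[k]=\{1,\dots,k\}$, and let $\mathcal U_k$ be the monoid of uniform block permutations: set partitions $d$ of $[k]\cup[\bar k]$ such that every block contains as many elements of $[k]$ as of $[\bar k]$. The product $dd'$ is obtained by stacking $d$ on top of $d'$, taking connected components and removing the middle row. Let $\mathsf{top}(d)$, $\mathsf{bot}(d)$ be the set partitions of $[k]$ induced by $d$ on the top row and on the bottom row, and write $d\le d'$ if every block of $d$ is contained in a block of $d'$. The type of a set partition of $[k]$ is the partition of $k$ formed by its block sizes. For a set partition $\pi$ of $[k]$ put $e_\pi=\{A\cup\bar A: A\in\pi\}$, $L_\pi=\{d:\mathsf{bot}(d)=\pi\}$ (the $\mathscr L$-class of $e_\pi$) and $G_{e_\pi}=\{d:\mathsf{top}(d)=\mathsf{bot}(d)=\pi\}$ (the maximal subgroup of $\mathcal U_k$ at $e_\pi$, which permutes the blocks of $\pi$ preserving their sizes). If $\gamma$ and $\pi$ have the same type, let $\ell_\pi^\gamma\in L_\pi$ be the diagram joining the $i$-th block of $\gamma$ (top row) to the $i$-th block of $\pi$ (bottom row) for all $i$, the blocks being listed by increasing size, and by increasing maximal element among blocks of equal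 size. For a partition $\lambda$ of $k$ let $\pi_\lambda$ be the set partition of $[k]$ into consecutive intervals whose lengths are the parts of $\lambda$ in weakly increasing order, and let $G_\lambda=G_{e_{\pi_\lambda}}$. Let $I_k$ be the set of sequences $\vec\lambda=(\lambda^{(1)},\dots,\lambda^{(k)})$ of integer partitions with $\sum_i i\,|\lambda^{(i)}|=k$, and let $\overrightarrow{\mathsf{type}}(\vec\lambda)=(1^{a_1}\cdots k^{a_k})$, where $a_i=|\lambda^{(i)}|$. For $\vec\lambda\in I_k$ and $\lambda=\overrightarrow{\mathsf{type}}(\vec\lambda)$, let $V^{\vec\lambda}_{G_\lambda}$ be the irreducible complex representation of $G_\lambda$ that is the tensor product over $i$ of the Specht modules of shape $\lambda^{(i)}$ of the symmetric groups on the blocks of $\pi_\lambda$ of size $i$, and let $\chi^{\vec\lambda}_{G_\lambda}$ be its character. Let $W^{\vec\lambda}_{\mathcal U_k}=\mathbb C L_{\pi_\lambda}\otimes_{\mathbb C G_\lambda}V^{\vec\lambda}_{G_\lambda}$ be the corresponding irreducible representation of $\mathcal U_k$, where $m\cdot(\ell\otimes v)$ is $m\ell\otimes v$ if $m\ell\in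 L_{\pi_\lambda}$ and $0$ otherwise, and let $\chi^{\vec\lambda}_{\mathcal U_k}$ be its character (the trace). For $\vec\mu\in I_k$ let $C_{\vec\mu}$ be the generalized conjugacy class of all $x\in\mathcal U_k$ of cycle type $\vec\mu$: if $x^\omega=e_\pi$ is the idempotent power of $x$, then for every $i$ the permutation induced by $x^{\omega+1}\in G_{e_\pi}$ on the blocks of $\pi$ of size $i$ has cycle type $\mu^{(i)}$. **Proposition.** Let $\vec\lambda,\vec\mu\in I_k$, let $\lambda=\overrightarrow{\mathsf{type}}(\vec\lambda)$, and let $d_{\vec\mu}$ be any element of $C_{\vec\mu}$. Put $$C(d_{\vec\mu};\lambda)=\{d\in\mathcal U_k: d\ge d_{\vec\mu},\ \mathsf{top}(d)=\mathsf{bot}(d),\ \mathsf{type}(\mathsf{top}(d))=\lambda\}.$$ Then for each $d\in C(d_{\vec\mu};\lambda)$ there is a unique $\sigma_d\in G_\lambda$ with $d\,\ell_{\pi_\lambda}^{\mathsf{top}(d)}=\ell_{\pi_\lambda}^{\mathsf{top}(d)}\,\sigma_d$, and $$\chi^{\vec\lambda}_{\mathcal U_k}(d_{\vec\mu})=\sum_{d\in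 C(d_{\vec\mu};\lambda)}\chi^{\vec\lambda}_{G_\lambda}(\sigma_d).$$ -/

import Mathlib

/-- A uniform block permutation of size `k`: a set partition of `[k] ∪ [k̄]` each of whose blocks
contains as many elements of `[k]` as of `[k̄]`. Set partitions are encoded as equivalence
relations; `Sum.inl i` is the top vertex `i`, `Sum.inr i` is the bottom vertex `ī`. -/
@[ext]
structure UBP (k : ℕ) where
  rel : Setoid (Fin k ⊕ Fin k)
  uniform : ∀ x, Nat.card {i : Fin k // rel (Sum.inl i) x} =
    Nat.card {j : Fin k // rel (Sum.inr j) x}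

namespace UBP

variable {k : ℕ}

/-- Refinement order: `d ≤ d'` if every block of `d` is contained in a block of `d'`. -/
instance : PartialOrder (UBP k) := PartialOrder.lift UBP.rel (fun _ _ => UBP.ext)

noncomputable instance : Fintype (UBP k) :=
  haveI : Finite (Setoid (Fin k ⊕ Fin k)) :=
    Finite.of_injective (fun r : Setoid (Fin k ⊕ Fin k) => fun x y => r x y)
      (fun r s h => Setoid.ext fun x y => by simpa using congrFun (congrFun h x) y)
  haveI : Finite (UBP k) := Finite.of_injective UBP.rel (fun _ _ => UBP.ext)
  Fintype.ofFinite _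

/-- The set partition of `[k]` induced on the top row. -/
def top (d : UBP k) : Setoid (Fin k) := d.rel.comap Sum.inl

/-- The set partition of `[k]` induced on the bottom row. -/
def bot (d : UBP k) : Setoid (Fin k) := d.rel.comap Sum.inr

theorem exists_perm (d : UBP k) :
    ∃ s : Equiv.Perm (Fin k), ∀ i, d.rel (Sum.inl i) (Sum.inr (s i)) := by
  classical
  have h : ∀ q : Quotient d.rel,
      Nonempty ({i : Fin k // (Quotient.mk d.rel (Sum.inl i)) = q} ≃
        {j : Fin k // (Quotient.mk d.rel (Sum.inr j)) = q}) := by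
    intro q
    induction q using Quotient.inductionOn with
    | h x =>
      have e1 : {i : Fin k // (Quotient.mk d.rel (Sum.inl i)) = Quotient.mk d.rel x} ≃
          {i : Fin k // d.rel (Sum.inl i) x} :=
        Equiv.subtypeEquivRight fun i => Quotient.eq
      have e2 : {i : Fin k // (Quotient.mk d.rel (Sum.inr i)) = Quotient.mk d.rel x} ≃
          {i : Fin k // d.rel (Sum.inr i) x} :=
        Equiv.subtypeEquivRight fun i => Quotient.eq
      obtain ⟨f⟩ := Finite.card_eq.1 (d.uniform x)
      exact ⟨e1.trans (f.trans e2.symm)⟩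
  let e := fun q => (h q).some
  refine ⟨(Equiv.sigmaFiberEquiv fun i => Quotient.mk d.rel (Sum.inl i)).symm.trans
    ((Equiv.sigmaCongrRight e).trans
      (Equiv.sigmaFiberEquiv fun i => Quotient.mk d.rel (Sum.inr i))), fun i => ?_⟩
  apply Quotient.exact
  exact ((e _ ⟨i, rfl⟩).2).symm

theorem uniform_of_perm (r : Setoid (Fin k ⊕ Fin k)) (s : Equiv.Perm (Fin k))
    (h : ∀ i, r (Sum.inl i) (Sum.inr (s i))) (x : Fin k ⊕ Fin k) :
    Nat.card {i : Fin k // r (Sum.inl i) x} = Nat.card {j : Fin k // r (Sum.inr j) x} :=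
  Nat.card_congr (s.subtypeEquiv fun i =>
    ⟨fun h1 => r.trans (r.symm (h i)) h1, fun h1 => r.trans (h i) h1⟩)

/-- The three-row diagram with `d` on top of `d'`: rows `1, 2, 3` are `Sum.inl`,
`Sum.inr ∘ Sum.inl`, `Sum.inr ∘ Sum.inr`. Its blocks are the connected components. -/
def stack (d d' : UBP k) : Setoid (Fin k ⊕ Fin k ⊕ Fin k) :=
  d.rel.map (Sum.map id Sum.inl) ⊔ d'.rel.map Sum.inr

theorem map_le_iff {α β : Type} (f : α → β) (r : Setoid α) (s : Setoid β) :
    r.map f ≤ s ↔ r ≤ s.comap f := by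
  constructor
  · intro h x y hxy
    exact h (Relation.EqvGen.rel _ _ ⟨x, y, hxy, rfl, rfl⟩)
  · intro h x y hxy
    induction hxy with
    | rel _ _ h1 => obtain ⟨a, b, hab, rfl, rfl⟩ := h1; exact h hab
    | refl _ => exact s.refl _
    | symm _ _ _ ih => exact s.symm ih
    | trans _ _ _ _ _ ih1 ih2 => exact s.trans ih1 ih2

theorem le_stack_left (d d' : UBP k) :
    d.rel ≤ (stack d d').comap (Sum.map id Sum.inl) :=
  (map_le_iff _ _ _).1 le_sup_left

theorem le_stack_right (d d' : UBP k) : d'.rel ≤ (stack d d').comap Sum.inr :=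
  (map_le_iff _ _ _).1 le_sup_right

/-- The product of diagrams: connected components of the three-row diagram, with the middle row
removed. -/
instance : Mul (UBP k) where
  mul d d' :=
    { rel := (stack d d').comap (Sum.map id Sum.inr)
      uniform := by
        obtain ⟨s, hs⟩ := d.exists_perm
        obtain ⟨s', hs'⟩ := d'.exists_perm
        refine uniform_of_perm _ (s.trans s') fun i => ?_
        exact (stack d d').trans (le_stack_left d d' (hs i)) (le_stack_right d d' (hs' (s i))) }

theorem mul_rel (d d' : UBP k) :
    (d * d').rel = (stack d d').comap (Sum.map id Sum.inr) := rfl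

/-- The idempotent `e_π`, with blocks `A ∪ Ā` for `A` a block of `π`. -/
def e (π : Setoid (Fin k)) : UBP k where
  rel := π.comap (Sum.elim id id)
  uniform := uniform_of_perm _ 1 fun i => π.refl i

instance : One (UBP k) := ⟨e ⊥⟩

/-- Reflection of a diagram across a horizontal line. -/
def flip (d : UBP k) : UBP k where
  rel := d.rel.comap Sum.swap
  uniform := by
    obtain ⟨s, hs⟩ := d.exists_perm
    refine uniform_of_perm _ s⁻¹ fun i => ?_
    have := hs (s⁻¹ i)
    rw [← Equiv.Perm.mul_apply, mul_inv_cancel, Equiv.Perm.one_apply] at this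
    exact d.rel.symm this

theorem mul_le_ker (d d' : UBP k) {T : Type} (f h : Fin k → T) :
    (d * d').rel ≤ Setoid.ker (Sum.elim f h) ↔
      ∃ g : Fin k → T, d.rel ≤ Setoid.ker (Sum.elim f g) ∧
        d'.rel ≤ Setoid.ker (Sum.elim g h) := by
  constructor
  · intro H
    obtain ⟨s, hs⟩ := d.exists_perm
    obtain ⟨s', hs'⟩ := d'.exists_perm
    have key : stack d d' ≤ Setoid.ker (Sum.elim f (Sum.elim (f ∘ s.symm) h)) := by
      -- move every middle vertex to a top vertex of the same component
      let t : Fin k ⊕ Fin k ⊕ Fin k → Fin k ⊕ Fin k :=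
        Sum.elim Sum.inl (Sum.elim (Sum.inl ∘ s.symm) Sum.inr)
      have ht : ∀ x, stack d d' x (Sum.map id Sum.inr (t x)) := by
        rintro (i | i | i)
        · exact (stack d d').refl _
        · have := le_stack_left d d' (hs (s.symm i))
          rw [Equiv.apply_symm_apply] at this
          exact (stack d d').symm this
        · exact (stack d d').refl _
      have ht2 : ∀ x, Sum.elim f h (t x) = Sum.elim f (Sum.elim (f ∘ s.symm) h) x := by
        rintro (i | i | i) <;> rfl
      intro x y hxy
      have h1 : (d * d').rel (t x) (t y) :=
        (stack d d').trans ((stack d d').symm (ht x)) ((stack d d').trans hxy (ht y))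
      have h2 := H h1
      rw [Setoid.ker_def, ht2, ht2] at h2
      exact h2
    refine ⟨f ∘ s.symm, fun x y hxy => ?_, fun x y hxy => ?_⟩
    · have := key (le_stack_left d d' hxy)
      rcases x with x | x <;> rcases y with y | y <;> exact this
    · exact key (le_stack_right d d' hxy)
  · rintro ⟨g, h1, h2⟩
    have key : stack d d' ≤ Setoid.ker (Sum.elim f (Sum.elim g h)) := by
      refine sup_le ((map_le_iff _ _ _).2 fun x y hxy => ?_)
        ((map_le_iff _ _ _).2 fun x y hxy => h2 hxy)
      have := h1 hxy
      rcases x with x | x <;> rcases y with y | y <;> exact this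
    intro x y hxy
    have := key hxy
    rcases x with x | x <;> rcases y with y | y <;> exact this

theorem e_le_ker (π : Setoid (Fin k)) {T : Type} (f h : Fin k → T) :
    (e π).rel ≤ Setoid.ker (Sum.elim f h) ↔ f = h ∧ π ≤ Setoid.ker f := by
  constructor
  · intro H
    refine ⟨funext fun i => H (x := Sum.inl i) (y := Sum.inr i) (π.refl i), fun x y hxy => ?_⟩
    exact H (x := Sum.inl x) (y := Sum.inl y) hxy
  · rintro ⟨rfl, H⟩ x y hxy
    have := H (x := Sum.elim id id x) (y := Sum.elim id id y) hxy
    rcases x with x | x <;> rcases y with y | y <;> exact this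

theorem flip_le_ker (d : UBP k) {T : Type} (f h : Fin k → T) :
    d.flip.rel ≤ Setoid.ker (Sum.elim f h) ↔ d.rel ≤ Setoid.ker (Sum.elim h f) := by
  constructor
  · intro H x y hxy
    have := H (x := x.swap) (y := y.swap)
      (by change d.rel _ _; rwa [Sum.swap_swap, Sum.swap_swap])
    rcases x with x | x <;> rcases y with y | y <;> exact this
  · intro H x y hxy
    have := H (x := x.swap) (y := y.swap) hxy
    rcases x with x | x <;> rcases y with y | y <;> exact this

theorem top_le_ker (d : UBP k) {T : Type} (f : Fin k → T) :
    d.top ≤ Setoid.ker f ↔ ∃ h : Fin k → T, d.rel ≤ Setoid.ker (Sum.elim f h) := by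
  constructor
  · intro H
    obtain ⟨s, hs⟩ := d.exists_perm
    let t : Fin k ⊕ Fin k → Fin k := Sum.elim id s.symm
    have ht : ∀ x, d.rel x (Sum.inl (t x)) := by
      rintro (i | i)
      · exact d.rel.refl _
      · have := hs (s.symm i)
        rw [Equiv.apply_symm_apply] at this
        exact d.rel.symm this
    refine ⟨f ∘ s.symm, fun x y hxy => ?_⟩
    have := H (x := t x) (y := t y)
      (d.rel.trans (d.rel.symm (ht x)) (d.rel.trans hxy (ht y)))
    rcases x with x | x <;> rcases y with y | y <;> exact this
  · rintro ⟨h, H⟩ x y hxy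
    exact H (x := Sum.inl x) (y := Sum.inl y) hxy

theorem bot_eq_top_flip (d : UBP k) : d.bot = d.flip.top := rfl

theorem bot_le_ker (d : UBP k) {T : Type} (f : Fin k → T) :
    d.bot ≤ Setoid.ker f ↔ ∃ h : Fin k → T, d.rel ≤ Setoid.ker (Sum.elim h f) := by
  rw [bot_eq_top_flip, top_le_ker]
  simp only [flip_le_ker]

theorem setoid_ext_ker {α : Type} {r s : Setoid α}
    (H : ∀ (T : Type) (f : α → T), r ≤ Setoid.ker f ↔ s ≤ Setoid.ker f) : r = s := by
  apply le_antisymm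
  · have := (H _ (Quotient.mk'' : α → Quotient s)).2 (by rw [Setoid.ker_mk_eq])
    rwa [Setoid.ker_mk_eq] at this
  · have := (H _ (Quotient.mk'' : α → Quotient r)).1 (by rw [Setoid.ker_mk_eq])
    rwa [Setoid.ker_mk_eq] at this

theorem ext_ker {d d' : UBP k}
    (H : ∀ (T : Type) (f h : Fin k → T), d.rel ≤ Setoid.ker (Sum.elim f h) ↔
      d'.rel ≤ Setoid.ker (Sum.elim f h)) : d = d' := by
  refine UBP.ext (setoid_ext_ker fun T f => ?_)
  rw [← Sum.elim_comp_inl_inr f]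
  exact H T _ _

instance : Monoid (UBP k) where
  mul_assoc a b c := ext_ker fun T f h => by
    simp only [mul_le_ker]
    constructor
    · rintro ⟨g, ⟨g', h1, h2⟩, h3⟩; exact ⟨g', h1, g, h2, h3⟩
    · rintro ⟨g', h1, g, h2, h3⟩; exact ⟨g, ⟨g', h1, h2⟩, h3⟩
  one_mul a := ext_ker fun T f h => by
    change ((e ⊥) * a).rel ≤ _ ↔ _
    simp only [mul_le_ker, e_le_ker]
    constructor
    · rintro ⟨g, ⟨rfl, _⟩, h1⟩; exact h1
    · intro h1; exact ⟨f, ⟨rfl, bot_le⟩, h1⟩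
  mul_one a := ext_ker fun T f h => by
    change (a * (e ⊥)).rel ≤ _ ↔ _
    simp only [mul_le_ker, e_le_ker]
    constructor
    · rintro ⟨g, h1, ⟨rfl, _⟩⟩; exact h1
    · intro h1; exact ⟨h, h1, ⟨rfl, bot_le⟩⟩

theorem top_e (π : Setoid (Fin k)) : (e π).top = π := rfl

theorem bot_e (π : Setoid (Fin k)) : (e π).bot = π := rfl

theorem e_top_mul (d : UBP k) : e d.top * d = d := ext_ker fun T f h => by
  simp only [mul_le_ker, e_le_ker, top_le_ker]
  constructor
  · rintro ⟨g, ⟨rfl, _⟩, h1⟩; exact h1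
  · intro h1; exact ⟨f, ⟨rfl, h, h1⟩, h1⟩

theorem mul_e_bot (d : UBP k) : d * e d.bot = d := ext_ker fun T f h => by
  simp only [mul_le_ker, e_le_ker, bot_le_ker]
  constructor
  · rintro ⟨g, h1, ⟨rfl, _⟩⟩; exact h1
  · intro h1; exact ⟨h, h1, ⟨rfl, f, h1⟩⟩

theorem flip_flip (d : UBP k) : d.flip.flip = d := ext_ker fun T f h => by
  simp only [flip_le_ker]

theorem flip_mul (d d' : UBP k) : (d * d').flip = d'.flip * d.flip := ext_ker fun T f h => by
  simp only [flip_le_ker, mul_le_ker]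
  constructor
  · rintro ⟨g, h1, h2⟩; exact ⟨g, h2, h1⟩
  · rintro ⟨g, h1, h2⟩; exact ⟨g, h2, h1⟩

theorem mul_flip (d : UBP k) : d * d.flip = e d.top := ext_ker fun T f h => by
  simp only [mul_le_ker, e_le_ker, flip_le_ker, top_le_ker]
  constructor
  · rintro ⟨g, h1, h2⟩
    obtain ⟨s, hs⟩ := d.exists_perm
    exact ⟨funext fun i => (h1 (hs i)).trans (h2 (hs i)).symm, g, h1⟩
  · rintro ⟨rfl, g, h1⟩; exact ⟨g, h1, h1⟩

theorem flip_mul_self (d : UBP k) : d.flip * d = e d.bot := by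
  have := mul_flip d.flip
  rwa [flip_flip] at this

theorem bot_le_bot_mul (d d' : UBP k) : d'.bot ≤ (d * d').bot := by
  intro x y hxy
  exact le_stack_right d d' (x := Sum.inr x) (y := Sum.inr y) hxy

theorem top_mul (d d' : UBP k) (H : d.bot = d'.top) : (d * d').top = d.top :=
  setoid_ext_ker fun T f => by
    simp only [top_le_ker, mul_le_ker]
    constructor
    · rintro ⟨h, g, h1, h2⟩; exact ⟨g, h1⟩
    · rintro ⟨g, h1⟩
      have := (bot_le_ker d g).2 ⟨f, h1⟩
      rw [H, top_le_ker] at this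
      obtain ⟨h, h2⟩ := this
      exact ⟨h, g, h1, h2⟩

theorem bot_mul (d d' : UBP k) (H : d.bot = d'.top) : (d * d').bot = d'.bot := by
  rw [bot_eq_top_flip, flip_mul, top_mul _ _ (by exact H.symm)]
  rfl

end UBP

/-- The blocks of a set partition of `[k]`. -/
def Block {k : ℕ} (π : Setoid (Fin k)) : Type := Quotient π

namespace Block

variable {k : ℕ} {π : Setoid (Fin k)}

/-- The block of `π` containing `i`. -/
def of (π : Setoid (Fin k)) (i : Fin k) : Block π := Quotient.mk π i

theorem exists_of (B : Block π) : ∃ i, of π i = B := Quotient.exists_rep B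

theorem of_eq_of {i j : Fin k} : of π i = of π j ↔ π i j := Quotient.eq

instance : Finite (Block π) := inferInstanceAs (Finite (Quotient π))

noncomputable instance : Fintype (Block π) := Fintype.ofFinite _

open Classical in
/-- The elements of a block. -/
noncomputable def elems (B : Block π) : Finset (Fin k) := Finset.univ.filter fun i => of π i = B

theorem mem_elems {B : Block π} {i : Fin k} : i ∈ B.elems ↔ of π i = B := by simp [elems]

theorem elems_nonempty (B : Block π) : B.elems.Nonempty := by
  obtain ⟨i, hi⟩ := B.exists_of
  exact ⟨i, mem_elems.2 hi⟩

/-- The size of a block. -/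
noncomputable def size (B : Block π) : ℕ := B.elems.card

theorem size_pos (B : Block π) : 0 < B.size := B.elems_nonempty.card_pos

/-- Sort key for the graded last letter order: first the size, then the largest element. -/
noncomputable def key (B : Block π) : ℕ ×ₗ Fin k :=
  toLex (B.size, B.elems.max' B.elems_nonempty)

theorem key_injective : Function.Injective (key : Block π → ℕ ×ₗ Fin k) := by
  intro B C h
  have h2 : B.elems.max' B.elems_nonempty = C.elems.max' C.elems_nonempty :=
    congrArg (fun p => (ofLex p).2) h
  have hB := mem_elems.1 (B.elems.max'_mem B.elems_nonempty)
  have hC := mem_elems.1 (C.elems.max'_mem C.elems_nonempty)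
  rw [← hB, ← hC, h2]

/-- The graded last letter order on the blocks of a set partition. -/
noncomputable instance : LinearOrder (Block π) := LinearOrder.lift' key key_injective

theorem size_mono : Monotone (size : Block π → ℕ) := by
  intro B C h
  have : key B ≤ key C := h
  rw [Prod.Lex.le_iff] at this
  rcases this with h | h
  · exact le_of_lt h
  · exact le_of_eq h.1

end Block

/-- The type of a set partition of `[k]`: the integer partition of `k` formed by its block
sizes. -/
noncomputable def setPartitionType {k : ℕ} (π : Setoid (Fin k)) : Nat.Partition k where
  parts := Finset.univ.val.map (Block.size : Block π → ℕ)
  parts_pos := by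
    intro i hi
    obtain ⟨B, -, rfl⟩ := Multiset.mem_map.1 hi
    exact B.size_pos
  parts_sum := by
    have h := Finset.card_eq_sum_card_fiberwise (s := (Finset.univ : Finset (Fin k)))
      (t := (Finset.univ : Finset (Block π))) (f := Block.of π) (fun _ _ => Finset.mem_univ _)
    rw [Finset.card_univ, Fintype.card_fin] at h
    refine Eq.trans ?_ h.symm
    change ∑ B : Block π, B.size = _
    refine Finset.sum_congr rfl fun B _ => ?_
    unfold Block.size Block.elems
    congr 1
    ext i
    simp

/-- The composition of `k` whose parts are the parts of `lam` in weakly increasing order. -/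
def intervalComposition {k : ℕ} (lam : Nat.Partition k) : Composition k where
  blocks := lam.parts.sort (· ≤ ·)
  blocks_pos := fun hi => lam.parts_pos ((Multiset.mem_sort _).1 hi)
  blocks_sum := by
    rw [← Multiset.sum_coe, Multiset.sort_eq]
    exact lam.parts_sum

/-- The representative set partition `π_λ`: consecutive intervals of `[k]`, with lengths the
parts of `λ` in weakly increasing order. -/
def repPartition {k : ℕ} (lam : Nat.Partition k) : Setoid (Fin k) :=
  Setoid.ker (intervalComposition lam).index

theorem setPartitionType_repPartition {k : ℕ} (lam : Nat.Partition k) :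
    setPartitionType (repPartition lam) = lam := by
  classical
  set c := intervalComposition lam with hc
  have hsurj : Function.Surjective c.index := fun i =>
    ⟨c.embedding i ⟨0, c.blocks_pos' i i.2⟩, c.index_embedding _ _⟩
  let E : Block (repPartition lam) ≃ Fin c.length :=
    Equiv.ofBijective (Quotient.lift (s := repPartition lam) c.index fun _ _ h => h)
      ⟨by
        rintro ⟨i⟩ ⟨j⟩ h
        exact Quotient.sound h, fun i => by
        obtain ⟨j, hj⟩ := hsurj i
        exact ⟨Quotient.mk _ j, hj⟩⟩
  have hE : ∀ i, E (Block.of _ i) = c.index i := fun i => rfl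
  have hsize : ∀ B, B.size = c.blocksFun (E B) := by
    intro B
    have : B.elems = Finset.univ.map (c.embedding (E B)).toEmbedding := by
      ext i
      rw [Block.mem_elems, ← E.injective.eq_iff, hE]
      simp only [Finset.mem_map, Finset.mem_univ, true_and]
      have := c.mem_range_embedding_iff' (j := i) (i := E B)
      rw [Set.mem_range] at this
      exact ⟨fun h => this.2 h.symm, fun h => (this.1 h).symm⟩
    rw [Block.size, this, Finset.card_map, Finset.card_univ, Fintype.card_fin]
  apply Nat.Partition.ext
  change Finset.univ.val.map _ = _
  rw [show (Block.size : Block (repPartition lam) → ℕ) = c.blocksFun ∘ E from funext hsize,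
    ← Multiset.map_map, Multiset.map_univ_val_equiv]
  have h1 : (Finset.univ : Finset (Fin c.length)).val.map c.blocksFun = (c.blocks : Multiset ℕ) := by
    rw [Fin.univ_val_map, c.ofFn_blocksFun]
  rw [h1]
  exact Multiset.sort_eq _ _

/-- If two set partitions have the same type, then listing their blocks in graded last letter
order gives blocks of equal sizes. -/
theorem exists_orderIso_block {k : ℕ} {γ π : Setoid (Fin k)}
    (h : setPartitionType γ = setPartitionType π) :
    ∃ f : Block γ ≃o Block π, ∀ B, (f B).size = B.size := by
  have hm : Finset.univ.val.map (Block.size : Block γ → ℕ) =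
      Finset.univ.val.map (Block.size : Block π → ℕ) := congrArg Nat.Partition.parts h
  have hcard : Fintype.card (Block γ) = Fintype.card (Block π) := by
    simpa using congrArg Multiset.card hm
  let a := monoEquivOfFin (Block γ) rfl
  let b := monoEquivOfFin (Block π) hcard.symm
  have key : List.ofFn (fun i => (a i).size) = List.ofFn (fun i => (b i).size) := by
    apply List.Perm.eq_of_sortedLE
    · rw [List.sortedLE_ofFn_iff]
      exact Block.size_mono.comp a.monotone
    · rw [List.sortedLE_ofFn_iff]
      exact Block.size_mono.comp b.monotone
    · rw [← Multiset.coe_eq_coe, ← Fin.univ_val_map, ← Fin.univ_val_map]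
      have ha : (fun i => (a i).size) = Block.size ∘ a.toEquiv := rfl
      have hb : (fun i => (b i).size) = Block.size ∘ b.toEquiv := rfl
      rw [ha, hb, ← Multiset.map_map, ← Multiset.map_map, Multiset.map_univ_val_equiv,
        Multiset.map_univ_val_equiv, hm]
  refine ⟨a.symm.trans b, fun B => ?_⟩
  have := congrFun (List.ofFn_injective key) (a.symm B)
  simpa using this.symm

namespace UBP

variable {k : ℕ}

/-- The uniform block permutation with blocks `B ∪ (f B)‾`, for a size-preserving bijection `f`
from the blocks of `γ` to the blocks of `π`. -/
def ofBlockEquiv {γ π : Setoid (Fin k)} (f : Block γ ≃ Block π)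
    (hf : ∀ B, (f B).size = B.size) : UBP k where
  rel := Setoid.ker (Sum.elim (fun i => f (Block.of γ i)) (fun j => Block.of π j))
  uniform := by
    intro x
    set B : Block π := Sum.elim (fun i => f (Block.of γ i)) (fun j => Block.of π j) x
    have h1 : Nat.card {i : Fin k // f (Block.of γ i) = B} = (f.symm B).elems.card :=
      Nat.subtype_card _ fun i => by rw [Block.mem_elems, Equiv.eq_symm_apply]
    have h2 : Nat.card {j : Fin k // Block.of π j = B} = B.elems.card :=
      Nat.subtype_card _ fun i => Block.mem_elems
    have h3 := hf (f.symm B)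
    rw [Equiv.apply_symm_apply] at h3
    exact h1.trans (h3.symm.trans h2.symm)

/-- The orbit representative `ℓ_π^γ`: the diagram that joins the `i`-th block of `γ` (top row) to
the `i`-th block of `π` (bottom row), where blocks are listed in graded last letter order. -/
noncomputable def orbitRep (γ π : Setoid (Fin k))
    (h : setPartitionType γ = setPartitionType π) : UBP k :=
  ofBlockEquiv (exists_orderIso_block h).choose.toEquiv (exists_orderIso_block h).choose_spec

end UBP

/-- The maximal subgroup `G_{e_π}` of the monoid of uniform block permutations: the diagrams `d`
with `top d = bot d = π`. -/
@[ext]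
structure MaxSubgroup {k : ℕ} (π : Setoid (Fin k)) where
  diag : UBP k
  top_diag : diag.top = π
  bot_diag : diag.bot = π

namespace MaxSubgroup

variable {k : ℕ} {π : Setoid (Fin k)}

/-- The group structure: product of diagrams, identity `e_π`, inverse the reflected diagram. -/
instance : Group (MaxSubgroup π) where
  mul g h := ⟨g.diag * h.diag,
    (UBP.top_mul _ _ (g.bot_diag.trans h.top_diag.symm)).trans g.top_diag,
    (UBP.bot_mul _ _ (g.bot_diag.trans h.top_diag.symm)).trans h.bot_diag⟩
  one := ⟨UBP.e π, rfl, rfl⟩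
  inv g := ⟨g.diag.flip, g.bot_diag, g.top_diag⟩
  mul_assoc a b c := MaxSubgroup.ext (mul_assoc a.diag b.diag c.diag)
  one_mul a := MaxSubgroup.ext (by
    have := UBP.e_top_mul a.diag
    rwa [a.top_diag] at this)
  mul_one a := MaxSubgroup.ext (by
    have := UBP.mul_e_bot a.diag
    rwa [a.bot_diag] at this)
  inv_mul_cancel a := MaxSubgroup.ext (by
    have := UBP.flip_mul_self a.diag
    rwa [a.bot_diag] at this)

theorem diag_mul (g h : MaxSubgroup π) : (g * h).diag = g.diag * h.diag := rfl

theorem diag_one : (1 : MaxSubgroup π).diag = UBP.e π := rfl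

theorem exists_block (g : MaxSubgroup π) (B : Block π) :
    ∃ C : Block π, ∀ i j, Block.of π j = B →
      (g.diag.rel (Sum.inl i) (Sum.inr j) ↔ Block.of π i = C) := by
  obtain ⟨s, hs⟩ := g.diag.exists_perm
  obtain ⟨j₀, rfl⟩ := B.exists_of
  have htop : ∀ i i', g.diag.rel (Sum.inl i) (Sum.inl i') ↔ π i i' := fun i i' => by
    conv_rhs => rw [← g.top_diag]
    rfl
  have hbot : ∀ i i', g.diag.rel (Sum.inr i) (Sum.inr i') ↔ π i i' := fun i i' => by
    conv_rhs => rw [← g.bot_diag]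
    rfl
  have h0 : g.diag.rel (Sum.inl (s.symm j₀)) (Sum.inr j₀) := by
    have := hs (s.symm j₀)
    rwa [Equiv.apply_symm_apply] at this
  refine ⟨Block.of π (s.symm j₀), fun i j hj => ?_⟩
  have hj' := (hbot _ _).2 (Block.of_eq_of.1 hj)
  rw [Block.of_eq_of, ← htop]
  exact ⟨fun h => g.diag.rel.trans h (g.diag.rel.trans hj' (g.diag.rel.symm h0)),
    fun h => g.diag.rel.trans h (g.diag.rel.trans h0 (g.diag.rel.symm hj'))⟩

/-- The block of `π` in the top row that `g` joins to the block `B` of `π` in the bottom row.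
As diagrams multiply from top to bottom, this is the direction for which
`g ↦ (B ↦ g.act B)` is a left action of `G_{e_π}` on the blocks of `π`. -/
noncomputable def act (g : MaxSubgroup π) (B : Block π) : Block π := (g.exists_block B).choose

theorem act_of (g : MaxSubgroup π) (i j : Fin k) :
    g.act (Block.of π j) = Block.of π i ↔ g.diag.rel (Sum.inl i) (Sum.inr j) :=
  ((((g.exists_block (Block.of π j)).choose_spec i j rfl)).trans eq_comm).symm

theorem act_one (B : Block π) : (1 : MaxSubgroup π).act B = B := by
  obtain ⟨j, rfl⟩ := B.exists_of
  rw [act_of]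
  exact π.refl j

theorem act_mul (g h : MaxSubgroup π) (B : Block π) : (g * h).act B = g.act (h.act B) := by
  obtain ⟨j, rfl⟩ := B.exists_of
  obtain ⟨i, hi⟩ := (h.act (Block.of π j)).exists_of
  obtain ⟨l, hl⟩ := (g.act (Block.of π i)).exists_of
  rw [← hi, ← hl, act_of, diag_mul]
  have h1 := (act_of h i j).1 hi.symm
  have h2 := (act_of g l i).1 hl.symm
  exact (UBP.stack g.diag h.diag).trans (UBP.le_stack_left g.diag h.diag h2)
    (UBP.le_stack_right g.diag h.diag h1)

theorem size_act (g : MaxSubgroup π) (B : Block π) : (g.act B).size = B.size := by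
  obtain ⟨j, rfl⟩ := B.exists_of
  obtain ⟨i, hi⟩ := (g.act (Block.of π j)).exists_of
  have hij := (act_of g i j).1 hi.symm
  have h := g.diag.uniform (Sum.inr j)
  have h1 : Nat.card {i' // g.diag.rel (Sum.inl i') (Sum.inr j)} =
      (g.act (Block.of π j)).elems.card :=
    Nat.subtype_card _ fun i' => by rw [Block.mem_elems, ← act_of, eq_comm]
  have h2 : Nat.card {i' // g.diag.rel (Sum.inr i') (Sum.inr j)} = (Block.of π j).elems.card :=
    Nat.subtype_card _ fun i' => by
      rw [Block.mem_elems, Block.of_eq_of]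
      conv_lhs => rw [← g.bot_diag]
      rfl
  exact h1.symm.trans (h.trans h2)

end MaxSubgroup

noncomputable instance {k : ℕ} {π : Setoid (Fin k)} : MulAction (MaxSubgroup π) (Block π) where
  smul := MaxSubgroup.act
  one_smul := MaxSubgroup.act_one
  mul_smul := MaxSubgroup.act_mul

/-- The blocks of `π` of size `i`. -/
abbrev BlockOfSize {k : ℕ} (π : Setoid (Fin k)) (i : ℕ) : Type := {B : Block π // B.size = i}

noncomputable instance {k : ℕ} {π : Setoid (Fin k)} {i : ℕ} :
    MulAction (MaxSubgroup π) (BlockOfSize π i) where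
  smul g B := ⟨g • B.1, (g.size_act B.1).trans B.2⟩
  one_smul B := Subtype.ext (one_smul _ B.1)
  mul_smul g h B := Subtype.ext (mul_smul g h B.1)

/-- The complex vector space with basis `X`. -/
def FreeSpace (X : Type) : Type := X →₀ ℂ

namespace FreeSpace

noncomputable instance (X : Type) : AddCommGroup (FreeSpace X) :=
  inferInstanceAs (AddCommGroup (X →₀ ℂ))

noncomputable instance (X : Type) : Module ℂ (FreeSpace X) := inferInstanceAs (Module ℂ (X →₀ ℂ))

/-- The standard basis of `FreeSpace X`. -/
noncomputable def basis (X : Type) : Module.Basis X ℂ (FreeSpace X) :=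
  Module.Basis.ofRepr (LinearEquiv.refl ℂ (X →₀ ℂ))

end FreeSpace

/-! ### Specht modules -/

/-- A (bijective) tableau of shape `μ` with entries in `A`. -/
abbrev Tableau (μ : YoungDiagram) (A : Type) : Type := μ.cells ≃ A

/-- Two tableaux are row equivalent if every entry lies in the same row of both. -/
def rowEquiv (μ : YoungDiagram) (A : Type) : Setoid (Tableau μ A) :=
  Setoid.ker fun t => fun a => (t.symm a).1.1

/-- Tabloids: row equivalence classes of tableaux. -/
def Tabloid (μ : YoungDiagram) (A : Type) : Type := Quotient (rowEquiv μ A)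

/-- The row equivalence class of a tableau. -/
def Tabloid.mk {μ : YoungDiagram} {A : Type} (t : Tableau μ A) : Tabloid μ A :=
  Quotient.mk (rowEquiv μ A) t

instance (μ : YoungDiagram) (A : Type) : MulAction (Equiv.Perm A) (Tabloid μ A) where
  smul s := Quotient.map (fun t => t.trans s) fun _ _ h => funext fun a => congrFun h (s.symm a)
  one_smul := by rintro ⟨t⟩; rfl
  mul_smul := by rintro s s' ⟨t⟩; rfl

open Classical in
/-- The polytabloid `e_t`: the signed sum of the tabloids obtained from `t` by permuting its
entries within the columns. -/
noncomputable def polytabloid {μ : YoungDiagram} {A : Type} (t : Tableau μ A) :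
    FreeSpace (Tabloid μ A) :=
  ∑ c : Equiv.Perm μ.cells with ∀ x, (c x).1.2 = x.1.2,
    ((Equiv.Perm.sign c : ℤ) : ℂ) •
      FreeSpace.basis (Tabloid μ A) (Tabloid.mk (c.trans t))

/-- The permutation module on tabloids. -/
noncomputable def tabloidRep (μ : YoungDiagram) (A : Type) :
    Representation ℂ (Equiv.Perm A) (FreeSpace (Tabloid μ A)) where
  toFun s := (FreeSpace.basis _).constr ℂ fun x => FreeSpace.basis _ (s • x)
  map_one' := (FreeSpace.basis _).ext fun x => by simp
  map_mul' s s' := (FreeSpace.basis _).ext fun x => by simp [mul_smul]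

theorem tabloidRep_basis {μ : YoungDiagram} {A : Type} (s : Equiv.Perm A) (x : Tabloid μ A) :
    tabloidRep μ A s (FreeSpace.basis _ x) = FreeSpace.basis _ (s • x) :=
  (FreeSpace.basis _).constr_basis _ _ _

/-- The Specht module `S^μ`, the irreducible representation of the symmetric group on `A` indexed
by the partition `μ` of `|A|`: the span of the polytabloids. -/
noncomputable def spechtModule (μ : YoungDiagram) (A : Type) : Submodule ℂ (FreeSpace (Tabloid μ A)) :=
  Submodule.span ℂ (Set.range (polytabloid : Tableau μ A → _))

theorem spechtModule_le_comap (μ : YoungDiagram) (A : Type) (s : Equiv.Perm A) :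
    spechtModule μ A ≤ (spechtModule μ A).comap (tabloidRep μ A s) := by
  refine Submodule.span_le.2 ?_
  rintro _ ⟨t, rfl⟩
  refine Submodule.subset_span ⟨t.trans s, ?_⟩
  simp only [polytabloid, map_sum, map_smul]
  simp only [tabloidRep_basis]
  rfl

/-- The action of the symmetric group on the Specht module. -/
noncomputable def spechtRep (μ : YoungDiagram) (A : Type) :
    Representation ℂ (Equiv.Perm A) (spechtModule μ A) :=
  (tabloidRep μ A).subrepresentation (spechtModule μ A) (spechtModule_le_comap μ A)

/-! ### The index set and the irreducible representations -/

/-- The set `I_k` of sequences `(λ^(1), …, λ^(k))` of partitions with `∑ i |λ^(i)| = k`.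
Partitions are given by their Young diagrams; `shape i` is `λ^(i+1)`. -/
structure PartitionSeq (k : ℕ) where
  shape : Fin k → YoungDiagram
  sum_eq : ∑ i : Fin k, ((i : ℕ) + 1) * (shape i).card = k

/-- The partition `(1^{a_1} 2^{a_2} … k^{a_k})` with `a_i = |λ^(i)|`. -/
def PartitionSeq.type {k : ℕ} (lam : PartitionSeq k) : Nat.Partition k where
  parts := ∑ i : Fin k, Multiset.replicate (lam.shape i).card ((i : ℕ) + 1)
  parts_pos := by
    intro n hn
    obtain ⟨i, -, hi⟩ := Multiset.mem_sum.1 hn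
    rw [Multiset.eq_of_mem_replicate hi]
    exact Nat.succ_pos _
  parts_sum := by
    rw [← Multiset.coe_sumAddMonoidHom, map_sum]
    refine Eq.trans (Finset.sum_congr rfl fun i _ => ?_) lam.sum_eq
    simp [mul_comm]

open scoped TensorProduct

/-- The space of the irreducible representation of `G_{e_π}` indexed by `lam`: the tensor product
over `i` of the Specht modules of shape `λ^(i)` for the symmetric group on the blocks of `π` of
size `i`. -/
abbrev GroupIrrep {k : ℕ} (π : Setoid (Fin k)) (lam : PartitionSeq k) : Type :=
  ⨂[ℂ] i : Fin k, spechtModule (lam.shape i) (BlockOfSize π ((i : ℕ) + 1))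

/-- The irreducible representation `V^lam` of `G_{e_π}`. -/
noncomputable def groupIrrep {k : ℕ} (π : Setoid (Fin k)) (lam : PartitionSeq k) :
    Representation ℂ (MaxSubgroup π) (GroupIrrep π lam) :=
  PiTensorProduct.mapMonoidHom.comp (MonoidHom.pi fun i : Fin k =>
    (spechtRep (lam.shape i) (BlockOfSize π ((i : ℕ) + 1))).comp
      (MulAction.toPermHom (MaxSubgroup π) (BlockOfSize π ((i : ℕ) + 1))))

/-! ### Schützenberger representations and induction to the monoid -/

/-- The `ℒ`-class `L_π` of `e_π`: the diagrams `d` with `bot d = π`. -/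
@[ext]
structure LClass {k : ℕ} (π : Setoid (Fin k)) where
  diag : UBP k
  bot_diag : diag.bot = π

namespace LClass

variable {k : ℕ} {π : Setoid (Fin k)}

/-- Right multiplication of `L_π` by `G_{e_π}`. -/
def mulRight (l : LClass π) (g : MaxSubgroup π) : LClass π :=
  ⟨l.diag * g.diag, (UBP.bot_mul _ _ (l.bot_diag.trans g.top_diag.symm)).trans g.bot_diag⟩

open Classical in
/-- The action `⊙` on basis elements: `m ⊙ l = m l` if `m l ∈ L_π`, and `0` otherwise. -/
noncomputable def odot (m : UBP k) (l : LClass π) : FreeSpace (LClass π) :=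
  if h : (m * l.diag).bot = π then FreeSpace.basis (LClass π) ⟨m * l.diag, h⟩ else 0

theorem odot_of_bot {m : UBP k} {l : LClass π} (h : (m * l.diag).bot = π) :
    odot m l = FreeSpace.basis (LClass π) ⟨m * l.diag, h⟩ := dif_pos h

theorem odot_of_bot_ne {m : UBP k} {l : LClass π} (h : (m * l.diag).bot ≠ π) :
    odot m l = 0 := dif_neg h

/-- The left Schützenberger representation `ℂ L_π` of the monoid of uniform block permutations. -/
noncomputable def rep (π : Setoid (Fin k)) : Representation ℂ (UBP k) (FreeSpace (LClass π)) where
  toFun m := (FreeSpace.basis (LClass π)).constr ℂ (odot m)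
  map_one' := (FreeSpace.basis _).ext fun l => by
    have h : ((1 : UBP k) * l.diag).bot = π := by rw [one_mul]; exact l.bot_diag
    rw [Module.Basis.constr_basis, odot_of_bot h, Module.End.one_apply]
    congr 1
    exact LClass.ext (one_mul _)
  map_mul' m m' := (FreeSpace.basis _).ext fun l => by
    rw [Module.End.mul_apply, Module.Basis.constr_basis, Module.Basis.constr_basis]
    by_cases h : (m' * l.diag).bot = π
    · rw [odot_of_bot h, Module.Basis.constr_basis]
      by_cases h2 : (m * (m' * l.diag)).bot = π
      · rw [odot_of_bot (l := ⟨m' * l.diag, h⟩) h2, odot_of_bot (by rwa [mul_assoc])]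
        congr 1
        exact LClass.ext (mul_assoc _ _ _)
      · rw [odot_of_bot_ne (l := ⟨m' * l.diag, h⟩) h2, odot_of_bot_ne (by rwa [mul_assoc])]
    · rw [odot_of_bot_ne h, map_zero, odot_of_bot_ne]
      intro h2
      rw [mul_assoc] at h2
      exact h (le_antisymm ((UBP.bot_le_bot_mul m (m' * l.diag)).trans h2.le)
        (l.bot_diag.ge.trans (UBP.bot_le_bot_mul m' l.diag)))

theorem rep_basis (m : UBP k) (l : LClass π) :
    rep π m (FreeSpace.basis _ l) = odot m l :=
  (FreeSpace.basis _).constr_basis _ _ _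

end LClass

section Induction

variable {k : ℕ} {π : Setoid (Fin k)} {V : Type} [AddCommGroup V] [Module ℂ V]

/-- The relations `l g ⊗ v = l ⊗ g v` of the tensor product over the group algebra of `G_{e_π}`. -/
noncomputable def balancing (ρ : Representation ℂ (MaxSubgroup π) V) :
    Submodule ℂ ((FreeSpace (LClass π)) ⊗[ℂ] V) :=
  Submodule.span ℂ {x | ∃ (l : LClass π) (g : MaxSubgroup π) (v : V),
    x = FreeSpace.basis _ (l.mulRight g) ⊗ₜ[ℂ] v - FreeSpace.basis _ l ⊗ₜ[ℂ] ρ g v}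

theorem balancing_le_comap (ρ : Representation ℂ (MaxSubgroup π) V) (m : UBP k) :
    balancing ρ ≤ (balancing ρ).comap ((LClass.rep π m).rTensor V) := by
  refine Submodule.span_le.2 ?_
  rintro _ ⟨l, g, v, rfl⟩
  rw [SetLike.mem_coe, Submodule.mem_comap, map_sub, LinearMap.rTensor_tmul,
    LinearMap.rTensor_tmul, LClass.rep_basis, LClass.rep_basis]
  by_cases h : (m * l.diag).bot = π
  · have h2 : (m * (l.mulRight g).diag).bot = π := by
      change (m * (l.diag * g.diag)).bot = π
      rw [← mul_assoc]
      exact (LClass.mulRight (π := π) ⟨m * l.diag, h⟩ g).bot_diag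
    rw [LClass.odot_of_bot h, LClass.odot_of_bot h2]
    refine Submodule.subset_span ⟨⟨m * l.diag, h⟩, g, v, ?_⟩
    congr 3
    exact LClass.ext (mul_assoc _ _ _).symm
  · have h2 : (m * (l.mulRight g).diag).bot ≠ π := by
      intro h2
      apply h
      have h3 : (m * l.diag) = (LClass.mulRight (π := π) ⟨_, h2⟩ g⁻¹).diag := by
        change m * l.diag = m * (l.diag * g.diag) * (g⁻¹).diag
        rw [mul_assoc, mul_assoc, ← MaxSubgroup.diag_mul, mul_inv_cancel, MaxSubgroup.diag_one]
        conv_lhs => rw [← UBP.mul_e_bot l.diag, l.bot_diag]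
      rw [h3]
      exact (LClass.mulRight (π := π) ⟨_, h2⟩ g⁻¹).bot_diag
    rw [LClass.odot_of_bot_ne h, LClass.odot_of_bot_ne h2]
    simp

/-- The space `ℂ L_π ⊗_{ℂ G_{e_π}} V`. -/
abbrev Induced (ρ : Representation ℂ (MaxSubgroup π) V) : Type :=
  ((FreeSpace (LClass π)) ⊗[ℂ] V) ⧸ balancing ρ

/-- The induced representation `ℂ L_π ⊗_{ℂ G_{e_π}} V` of the monoid of uniform block
permutations, with action `m (l ⊗ v) = (m ⊙ l) ⊗ v`. -/
noncomputable def inducedRep (ρ : Representation ℂ (MaxSubgroup π) V) :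
    Representation ℂ (UBP k) (Induced ρ) where
  toFun m := (balancing ρ).mapQ (balancing ρ) ((LClass.rep π m).rTensor V)
    (balancing_le_comap ρ m)
  map_one' := by
    ext1
    simp [Module.End.one_eq_id, LinearMap.rTensor_id]
  map_mul' m m' := by
    refine Submodule.linearMap_qext _ (LinearMap.ext fun x => ?_)
    simp [Module.End.mul_eq_comp, LinearMap.rTensor_comp]

end Induction

/-- The irreducible representation `W^lam` of the monoid of uniform block permutations: induced
from the irreducible representation `V^lam` of `G_λ = G_{e_{π_λ}}`, where `λ` is the type
of `lam`. -/
noncomputable def monoidIrrep {k : ℕ} (lam : PartitionSeq k) :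
    Representation ℂ (UBP k) (Induced (groupIrrep (repPartition lam.type) lam)) :=
  inducedRep (groupIrrep (repPartition lam.type) lam)

/-! ### Generalized conjugacy classes -/

/-- The cycle type of `g ∈ G_{e_π}` is `mu`: for all `i`, the parts of `μ^(i)` are the lengths of
the cycles (fixed points included) of `g` on the blocks of `π` of size `i`. -/
def MaxSubgroup.HasCycleType {k : ℕ} {π : Setoid (Fin k)} (g : MaxSubgroup π)
    (mu : PartitionSeq k) : Prop :=
  ∀ i : Fin k, (MulAction.toPerm g : Equiv.Perm (BlockOfSize π ((i : ℕ) + 1))).partition.parts =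
    ((mu.shape i).rowLens : Multiset ℕ)

/-- The generalized conjugacy class `C_mu`: the elements `x` such that `x^{ω+1}`, as an element of
the maximal subgroup at the idempotent power `x^ω = e_π` of `x`, has cycle type `mu`. -/
def genConjClass {k : ℕ} (mu : PartitionSeq k) : Set (UBP k) :=
  {x | ∃ (w : ℕ) (π : Setoid (Fin k)) (g : MaxSubgroup π),
    0 < w ∧ x ^ w = UBP.e π ∧ x ^ (w + 1) = g.diag ∧ g.HasCycleType mu}

/-- The set `C(d; lam)` of all `c ≥ d` with `top c = bot c` of type `lam`. -/
def coarsenings {k : ℕ} (d : UBP k) (lam : Nat.Partition k) : Set (UBP k) :=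
  {c | d ≤ c ∧ c.top = c.bot ∧ setPartitionType c.top = lam}

noncomputable instance {k : ℕ} (d : UBP k) (lam : Nat.Partition k) :
    Fintype (coarsenings d lam) := Fintype.ofFinite _

/-- `ℓ_{π_λ}^{top c}` for `c ∈ C(d; λ)`. -/
noncomputable def topRep {k : ℕ} {d : UBP k} {lam : Nat.Partition k} (c : coarsenings d lam) :
    UBP k :=
  UBP.orbitRep c.1.top (repPartition lam)
    (c.2.2.2.trans (setPartitionType_repPartition lam).symm)

/-! Let `π` be the representative partition of type `λ`. Right multiplication makes `L_π` a free
`G_{e_π}`-set whose orbits are the fibres of the top row (`mulRight_quot`, `mulRight_injective`). A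
top row can be any set partition `γ` of type `λ`, so the induced module is the direct sum of the
spaces `ℓ_π^γ ⊗ V`, and the trace of `d` is the sum of the traces of its diagonal blocks
(`character_inducedRep`). The block at `γ` is `ρ g` if `d ℓ_π^γ = ℓ_π^γ g`; otherwise `d ℓ_π^γ`
leaves `L_π` or lands in another orbit, and the block is zero.

It remains to match the `γ` fixed by `d` with the coarsenings `c` of `d` that have equal rows of
type `λ`, through `c ↦ top c`. If `d ℓ = ℓ g` with `top ℓ = γ`, then `d e_γ = ℓ g ℓ.flip` is a
coarsening of `d` with both rows `γ` (`exists_coarsening`). Conversely, a coarsening `c` with both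
rows `γ` must be `d e_γ` (`mul_e_bot_of_le`). Hence `c` is determined by `γ`, and `c ℓ = d ℓ`
(`mul_eq_mul_of_le`), so the group element attached to `c` is the one that `d` produces. -/

namespace UBP

variable {k : ℕ}

/-! ### Refinement order, products and coarsenings -/

instance : Finite (Setoid (Fin k)) :=
  Finite.of_injective (fun r : Setoid (Fin k) => fun x y => r x y)
    fun _ _ h => Setoid.ext fun x y => by simpa using congrFun (congrFun h x) y

/-- The two rows are all that the character formula needs from `orbitRep`: any element of `L_π` with
top row `γ` would serve as representative of its orbit. -/
theorem top_orbitRep {γ π : Setoid (Fin k)} (h : setPartitionType γ = setPartitionType π) :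
    (orbitRep γ π h).top = γ :=
  Setoid.ext fun _ _ => (exists_orderIso_block h).choose.toEquiv.injective.eq_iff.trans
    Block.of_eq_of

theorem bot_orbitRep {γ π : Setoid (Fin k)} (h : setPartitionType γ = setPartitionType π) :
    (orbitRep γ π h).bot = π :=
  Setoid.ext fun _ _ => Block.of_eq_of

/-- Colourings of the two rows that are constant on blocks detect the order. Through `mul_le_ker`,
inequalities between products then reduce to finding a colouring of the middle row. -/
theorem le_iff_ker {d d' : UBP k} : d ≤ d' ↔ ∀ (T : Type) (f h : Fin k → T),
    d'.rel ≤ Setoid.ker (Sum.elim f h) → d.rel ≤ Setoid.ker (Sum.elim f h) := by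
  refine ⟨fun H T f h h' => le_trans H h', fun H => ?_⟩
  have := H _ ((Quotient.mk'' : _ → Quotient d'.rel) ∘ Sum.inl) (Quotient.mk'' ∘ Sum.inr)
  rw [Sum.elim_comp_inl_inr, Setoid.ker_mk_eq] at this
  exact this le_rfl

theorem le_mul_e (d : UBP k) (γ : Setoid (Fin k)) : d ≤ d * e γ :=
  le_iff_ker.2 fun T f h => by
    rw [mul_le_ker]
    rintro ⟨g, h1, h2⟩
    obtain ⟨rfl, -⟩ := (e_le_ker _ _ _).1 h2
    exact h1

theorem mul_le_mul_right_of_le {d d' : UBP k} (h : d ≤ d') (x : UBP k) : d * x ≤ d' * x :=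
  le_iff_ker.2 fun T f g => by
    simp only [mul_le_ker]
    rintro ⟨g', h1, h2⟩
    exact ⟨g', le_trans h h1, h2⟩

theorem bot_mono {d d' : UBP k} (h : d ≤ d') : d.bot ≤ d'.bot :=
  fun _ _ hxy => h hxy

/-- By uniformity every block of `d` reaches the bottom row, so merging two blocks of `d` would
already merge two blocks of `d.bot`. -/
theorem eq_of_le_of_bot_eq {d d' : UBP k} (h : d ≤ d') (hb : d'.bot = d.bot) : d = d' := by
  refine le_antisymm h fun x y hxy => ?_
  obtain ⟨s, hs⟩ := d.exists_perm
  have key : ∀ x, ∃ j, d.rel x (Sum.inr j) := by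
    rintro (i | j)
    exacts [⟨s i, hs i⟩, ⟨j, d.rel.refl _⟩]
  obtain ⟨i, hi⟩ := key x
  obtain ⟨j, hj⟩ := key y
  have hij : d'.bot i j := d'.rel.trans (d'.rel.symm (h hi)) (d'.rel.trans hxy (h hj))
  rw [hb] at hij
  exact d.rel.trans hi (d.rel.trans hij (d.rel.symm hj))

/-- A coarsening of `d` with equal top and bottom rows is determined by its rows. -/
theorem mul_e_bot_of_le {c d : UBP k} (h : d ≤ c) : d * e c.bot = c := by
  -- Multiply `d ≤ c` on the right by `e c.bot`, which `c` absorbs.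
  have h1 : d * e c.bot ≤ c := by
    simpa only [mul_e_bot] using mul_le_mul_right_of_le h (e c.bot)
  exact eq_of_le_of_bot_eq h1 (le_antisymm (bot_le_bot_mul d (e c.bot)) (bot_mono h1))

end UBP

/-! ### The free right action of the maximal subgroup on its `ℒ`-class -/

namespace LClass

variable {k : ℕ} {π : Setoid (Fin k)}

instance : Finite (LClass π) := Finite.of_injective LClass.diag fun _ _ => LClass.ext

/-- The element of `G_{e_π}` carrying `l` to `l'`, for `l` and `l'` with the same top row. -/
def quot (l l' : LClass π) (h : l.diag.top = l'.diag.top) : MaxSubgroup π :=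
  ⟨l.diag.flip * l'.diag, (UBP.top_mul l.diag.flip l'.diag h).trans l.bot_diag,
    (UBP.bot_mul l.diag.flip l'.diag h).trans l'.bot_diag⟩

/-- Transitivity on each fibre of the top row: `l * l.flip` is the idempotent of the common top row,
which fixes `l'` from the left. -/
theorem mulRight_quot (l l' : LClass π) (h : l.diag.top = l'.diag.top) :
    l.mulRight (l.quot l' h) = l' := by
  refine LClass.ext ?_
  change l.diag * (l.diag.flip * l'.diag) = _
  rw [← mul_assoc, UBP.mul_flip, h, UBP.e_top_mul]

/-- Freeness: since `l.flip * l = e π`, multiplying on the left by `l.flip` recovers `g`. -/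
theorem mulRight_injective (l : LClass π) : Function.Injective l.mulRight := by
  intro g g' h
  have key : ∀ g : MaxSubgroup π, l.diag.flip * (l.mulRight g).diag = g.diag := fun g => by
    change l.diag.flip * (l.diag * g.diag) = _
    have := UBP.e_top_mul g.diag
    rwa [g.top_diag.trans l.bot_diag.symm, ← UBP.flip_mul_self, mul_assoc] at this
  exact MaxSubgroup.ext (by rw [← key g, ← key g', h])

theorem top_mulRight (l : LClass π) (g : MaxSubgroup π) :
    (l.mulRight g).diag.top = l.diag.top :=
  UBP.top_mul _ _ (l.bot_diag.trans g.top_diag.symm)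

theorem mulRight_mul (l : LClass π) (g h : MaxSubgroup π) :
    l.mulRight (g * h) = (l.mulRight g).mulRight h :=
  LClass.ext (mul_assoc l.diag g.diag h.diag).symm

theorem quot_eq {l l' : LClass π} (h : l.diag.top = l'.diag.top) {g : MaxSubgroup π}
    (hg : l.mulRight g = l') : l.quot l' h = g :=
  l.mulRight_injective ((l.mulRight_quot l' h).trans hg.symm)

end LClass

/-! ### Trace through a decomposition of the identity -/

section Trace

/-- Write `f = ∑ f ∘ s i ∘ p i` and use cyclicity of the trace on each term. Orthogonality of the
pairs `s i`, `p i` plays no role. -/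
theorem trace_eq_sum_of_sum_comp_eq_id {ι V W : Type*} [Fintype ι] [AddCommGroup V] [Module ℂ V]
    [AddCommGroup W] [Module ℂ W] [Module.Finite ℂ V] [Module.Finite ℂ W]
    (s : ι → V →ₗ[ℂ] W) (p : ι → W →ₗ[ℂ] V) (h : ∑ i, s i ∘ₗ p i = LinearMap.id)
    (f : W →ₗ[ℂ] W) :
    LinearMap.trace ℂ W f = ∑ i, LinearMap.trace ℂ V (p i ∘ₗ f ∘ₗ s i) := by
  have hf : f = ∑ i, f ∘ₗ s i ∘ₗ p i := LinearMap.ext fun w => by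
    simpa [map_sum] using congrArg f (LinearMap.congr_fun h w).symm
  conv_lhs => rw [hf, map_sum]
  refine Finset.sum_congr rfl fun i _ => ?_
  rw [← LinearMap.comp_assoc, LinearMap.trace_comp_comm']

end Trace

/-! ### Block decomposition and character of the induced module -/

section Induction

variable {k : ℕ} {π : Setoid (Fin k)} {V : Type} [AddCommGroup V] [Module ℂ V]

instance FreeSpace.finite {X : Type} [Finite X] : Module.Finite ℂ (FreeSpace X) :=
  Module.Finite.of_basis (FreeSpace.basis X)

/-- The inclusion `v ↦ l ⊗ v` of `V` into the induced module. -/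
noncomputable def inducedIncl (ρ : Representation ℂ (MaxSubgroup π) V) (l : LClass π) :
    V →ₗ[ℂ] Induced ρ :=
  (balancing ρ).mkQ ∘ₗ TensorProduct.mk ℂ _ V (FreeSpace.basis _ l)

theorem inducedIncl_mulRight (ρ : Representation ℂ (MaxSubgroup π) V) (l : LClass π)
    (g : MaxSubgroup π) (v : V) :
    inducedIncl ρ (l.mulRight g) v = inducedIncl ρ l (ρ g v) :=
  (Submodule.Quotient.eq _).2 (Submodule.subset_span ⟨l, g, v, rfl⟩)

theorem inducedRep_incl (ρ : Representation ℂ (MaxSubgroup π) V) (m : UBP k) (l : LClass π)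
    (v : V) : inducedRep ρ m (inducedIncl ρ l v) =
      (balancing ρ).mkQ (LClass.odot m l ⊗ₜ[ℂ] v) := by
  rw [← LClass.rep_basis]
  rfl

theorem induced_hom_ext {ρ : Representation ℂ (MaxSubgroup π) V} {X : Type*} [AddCommGroup X]
    [Module ℂ X] {f g : Induced ρ →ₗ[ℂ] X}
    (h : ∀ l v, f (inducedIncl ρ l v) = g (inducedIncl ρ l v)) : f = g := by
  refine Submodule.linearMap_qext _ (TensorProduct.ext ((FreeSpace.basis _).ext fun l => ?_))
  exact LinearMap.ext fun v => h l v

open Classical in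
/-- The contribution to `inducedProj` of a basis vector `l'`. -/
noncomputable def inducedCoeff (ρ : Representation ℂ (MaxSubgroup π) V) (l l' : LClass π) :
    V →ₗ[ℂ] V :=
  if h : l.diag.top = l'.diag.top then ρ (l.quot l' h) else 0

/-- This is the balancing relation in coordinates; it lets the projection descend to the quotient.
It holds because the element carrying `l` to `l' g` is the one carrying `l` to `l'`, times `g`. -/
theorem inducedCoeff_mulRight (ρ : Representation ℂ (MaxSubgroup π) V) (l l' : LClass π)
    (g : MaxSubgroup π) : inducedCoeff ρ l (l'.mulRight g) = inducedCoeff ρ l l' ∘ₗ ρ g := by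
  by_cases h : l.diag.top = l'.diag.top
  · have h' : l.diag.top = (l'.mulRight g).diag.top := h.trans (l'.top_mulRight g).symm
    have h2 : l.quot _ h' = l.quot l' h * g := LClass.quot_eq h' (by
      rw [LClass.mulRight_mul, LClass.mulRight_quot])
    rw [inducedCoeff, inducedCoeff, dif_pos h, dif_pos h', h2, map_mul]
    rfl
  · have h' : ¬ l.diag.top = (l'.mulRight g).diag.top := by rwa [LClass.top_mulRight]
    rw [inducedCoeff, inducedCoeff, dif_neg h, dif_neg h', LinearMap.zero_comp]

/-- The projection of the induced module onto the summand `l ⊗ V`, identified with `V`. -/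
noncomputable def inducedProj (ρ : Representation ℂ (MaxSubgroup π) V) (l : LClass π) :
    Induced ρ →ₗ[ℂ] V :=
  (balancing ρ).liftQ
    (TensorProduct.lift ((FreeSpace.basis (LClass π)).constr ℂ (inducedCoeff ρ l))) (by
      refine Submodule.span_le.2 ?_
      rintro _ ⟨l', g, v, rfl⟩
      simp only [SetLike.mem_coe, LinearMap.mem_ker, map_sub, TensorProduct.lift.tmul,
        Module.Basis.constr_basis, inducedCoeff_mulRight, LinearMap.comp_apply, sub_self])

theorem inducedProj_incl (ρ : Representation ℂ (MaxSubgroup π) V) (l l' : LClass π) (v : V) :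
    inducedProj ρ l (inducedIncl ρ l' v) = inducedCoeff ρ l l' v := by
  change TensorProduct.lift ((FreeSpace.basis (LClass π)).constr ℂ (inducedCoeff ρ l))
    (FreeSpace.basis _ l' ⊗ₜ[ℂ] v) = _
  rw [TensorProduct.lift.tmul, Module.Basis.constr_basis]

/-- If `r` is a system of representatives for the right cosets of `G_{e_π}` in `L_π`, then the
character of the induced representation at `m` is a sum over the cosets fixed by `m`. -/
theorem character_inducedRep [Module.Finite ℂ V] (ρ : Representation ℂ (MaxSubgroup π) V)
    {ι : Type} [Fintype ι] (r : ι → LClass π)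
    (hr : ∀ l : LClass π, ∃! i, (r i).diag.top = l.diag.top) (m : UBP k) :
    (inducedRep ρ).character m =
      ∑ i, LinearMap.trace ℂ V (inducedProj ρ (r i) ∘ₗ inducedRep ρ m ∘ₗ inducedIncl ρ (r i)) := by
  refine trace_eq_sum_of_sum_comp_eq_id _ _ (induced_hom_ext fun l v => ?_) _
  obtain ⟨i, hi, huniq⟩ := hr l
  rw [LinearMap.sum_apply, Finset.sum_eq_single i]
  -- With `q` carrying `r i` to `l`, balancing gives `r i ⊗ q v = (r i) q ⊗ v = l ⊗ v`.
  · rw [LinearMap.comp_apply, inducedProj_incl, inducedCoeff, dif_pos hi, ← inducedIncl_mulRight,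
      LClass.mulRight_quot, LinearMap.id_apply]
  · intro j _ hj
    rw [LinearMap.comp_apply, inducedProj_incl, inducedCoeff, dif_neg fun h => hj (huniq j h),
      LinearMap.zero_apply, map_zero]
  · exact fun h => (h (Finset.mem_univ i)).elim

theorem inducedProj_comp_incl_of_eq (ρ : Representation ℂ (MaxSubgroup π) V) {m : UBP k}
    {l : LClass π} {g : MaxSubgroup π} (h : m * l.diag = l.diag * g.diag) :
    inducedProj ρ l ∘ₗ inducedRep ρ m ∘ₗ inducedIncl ρ l = ρ g := by
  have hb : (m * l.diag).bot = π := h ▸ (l.mulRight g).bot_diag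
  have hm : (⟨m * l.diag, hb⟩ : LClass π) = l.mulRight g := LClass.ext h
  refine LinearMap.ext fun v => ?_
  rw [LinearMap.comp_apply, LinearMap.comp_apply, inducedRep_incl, LClass.odot_of_bot hb, hm]
  refine (inducedProj_incl ρ l (l.mulRight g) v).trans ?_
  rw [inducedCoeff, dif_pos (l.top_mulRight g).symm, LClass.quot_eq _ rfl]

theorem inducedProj_comp_incl_of_ne (ρ : Representation ℂ (MaxSubgroup π) V) {m : UBP k}
    {l : LClass π} (h : ∀ g : MaxSubgroup π, m * l.diag ≠ l.diag * g.diag) :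
    inducedProj ρ l ∘ₗ inducedRep ρ m ∘ₗ inducedIncl ρ l = 0 := by
  refine LinearMap.ext fun v => ?_
  rw [LinearMap.comp_apply, LinearMap.comp_apply, inducedRep_incl]
  by_cases hb : (m * l.diag).bot = π
  · rw [LClass.odot_of_bot hb]
    refine (inducedProj_incl ρ l ⟨m * l.diag, hb⟩ v).trans ?_
    rw [inducedCoeff, dif_neg]
    -- If `m l` kept the top row of `l`, transitivity would produce a `g` with `m l = l g`.
    intro ht
    exact h _ (congrArg LClass.diag (l.mulRight_quot ⟨m * l.diag, hb⟩ ht)).symm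
  · rw [LClass.odot_of_bot_ne hb, TensorProduct.zero_tmul, map_zero, map_zero]
    rfl

end Induction

/-- Makes the Specht modules, and hence `GroupIrrep`, finite-dimensional, as `character_inducedRep`
requires. -/
instance Tabloid.finite {μ : YoungDiagram} {A : Type} [Finite A] : Finite (Tabloid μ A) :=
  inferInstanceAs (Finite (Quotient (rowEquiv μ A)))

/-! ### Top rows in the `ℒ`-class and orbits fixed by a diagram -/

namespace UBP

variable {k : ℕ}

/-- A permutation along the blocks of `d` carries the blocks of the top row to those of the bottom
row. Hence all top rows occurring in `L_π` have the type of `π`. -/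
theorem setPartitionType_top (d : UBP k) : setPartitionType d.top = setPartitionType d.bot := by
  obtain ⟨s, hs⟩ := d.exists_perm
  have hiff : ∀ i j, d.top i j ↔ d.bot (s i) (s j) := fun i j =>
    ⟨fun h => d.rel.trans (d.rel.symm (hs i)) (d.rel.trans h (hs j)),
      fun h => d.rel.trans (hs i) (d.rel.trans h (d.rel.symm (hs j)))⟩
  let E : Block d.top ≃ Block d.bot := Quotient.congr s hiff
  have hE : ∀ i, E (Block.of _ i) = Block.of _ (s i) := fun _ => rfl
  have hsize : ∀ B, B.size = (E B).size := fun B => by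
    refine Finset.card_equiv s fun i => ?_
    rw [Block.mem_elems, Block.mem_elems, ← hE, E.injective.eq_iff]
  refine Nat.Partition.ext ?_
  change Finset.univ.val.map _ = Finset.univ.val.map _
  rw [show (Block.size : Block d.top → ℕ) = Block.size ∘ E from funext hsize,
    ← Multiset.map_map, Multiset.map_univ_val_equiv]

/-- If `c ≥ d` has equal rows, then `c` and `d` act in the same way on diagrams whose top row is
that of `c`. -/
theorem mul_eq_mul_of_le {c d l : UBP k} (h : d ≤ c) (hl : l.top = c.bot) : d * l = c * l := by
  conv_lhs => rw [← e_top_mul l, hl, ← mul_assoc, mul_e_bot_of_le h]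

end UBP

/-- The element `ℓ_π^γ` of the `ℒ`-class `L_π`. -/
noncomputable def LClass.orbitRep {k : ℕ} {π : Setoid (Fin k)} (γ : Setoid (Fin k))
    (h : setPartitionType γ = setPartitionType π) : LClass π :=
  ⟨UBP.orbitRep γ π h, UBP.bot_orbitRep h⟩

theorem LClass.setPartitionType_top {k : ℕ} {π : Setoid (Fin k)} (l : LClass π) :
    setPartitionType l.diag.top = setPartitionType π :=
  l.diag.setPartitionType_top.trans (congrArg setPartitionType l.bot_diag)

/-- If `d` maps `l` into its coset `l G_{e_π}`, then `d e_{top l}` is a coarsening of `d` whose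
rows are both the top row of `l`. -/
theorem LClass.exists_coarsening {k : ℕ} {π : Setoid (Fin k)} {d : UBP k} {l : LClass π}
    {g : MaxSubgroup π} (h : d * l.diag = l.diag * g.diag) :
    ∃ c, d ≤ c ∧ c.top = l.diag.top ∧ c.bot = l.diag.top := by
  -- Substitute `e_{top l} = l * l.flip`; in the resulting product all adjacent rows agree, so its
  -- outer rows are those of `l` and `l.flip`.
  have h1 : d * UBP.e l.diag.top = l.diag * (g.diag * l.diag.flip) := by
    rw [← UBP.mul_flip, ← mul_assoc, h, mul_assoc]
  have h3 : g.diag.bot = l.diag.flip.top := g.bot_diag.trans l.bot_diag.symm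
  have h2 : (g.diag * l.diag.flip).top = π :=
    (UBP.top_mul _ _ h3).trans g.top_diag
  refine ⟨_, UBP.le_mul_e d l.diag.top, ?_, ?_⟩
  · rw [h1, UBP.top_mul _ _ (l.bot_diag.trans h2.symm)]
  · rw [h1, UBP.bot_mul _ _ (l.bot_diag.trans h2.symm),
      UBP.bot_mul _ _ h3]
    rfl

/-! ### The character formula -/

theorem mainTheorem4 (k : ℕ) (lam mu : PartitionSeq k) (d : UBP k) (hd : d ∈ genConjClass mu) :
    ∃ σ : coarsenings d lam.type → MaxSubgroup (repPartition lam.type),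
      (∀ c : coarsenings d lam.type,
        c.1 * topRep c = topRep c * (σ c).diag ∧
        ∀ g : MaxSubgroup (repPartition lam.type),
          c.1 * topRep c = topRep c * g.diag → g = σ c) ∧
      (monoidIrrep lam).character d =
        ∑ c : coarsenings d lam.type,
          (groupIrrep (repPartition lam.type) lam).character (σ c) := by
  set π := repPartition lam.type with hπ
  have hπt : setPartitionType π = lam.type := setPartitionType_repPartition _
  let ι := {γ : Setoid (Fin k) // setPartitionType γ = setPartitionType π}
  let _ : Fintype ι := Fintype.ofFinite ι
  let r : ι → LClass π := fun γ => LClass.orbitRep γ.1 γ.2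
  have hrtop : ∀ γ, (r γ).diag.top = γ.1 := fun γ => UBP.top_orbitRep γ.2
  -- The orbit attached to a coarsening; `topRep c` is definitionally `(r (t c)).diag`.
  let t : coarsenings d lam.type → ι := fun c => ⟨c.1.top, c.2.2.2.trans hπt.symm⟩
  have hsmul : ∀ c, d * (r (t c)).diag = c.1 * (r (t c)).diag := fun c =>
    UBP.mul_eq_mul_of_le c.2.1 ((hrtop _).trans c.2.2.1)
  have hex : ∀ c : coarsenings d lam.type, ∃ g : MaxSubgroup π,
      (r (t c)).diag * g.diag = c.1 * (r (t c)).diag := fun c => by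
    have hcb : c.1.bot = (r (t c)).diag.top := c.2.2.1.symm.trans (hrtop (t c)).symm
    -- As `c` has equal rows, `c ℓ` stays in `L_π` and keeps the top row of `ℓ`, so it lies in the
    -- orbit of `ℓ`.
    exact ⟨_, congrArg LClass.diag ((r (t c)).mulRight_quot
      ⟨_, (UBP.bot_mul _ _ hcb).trans (r (t c)).bot_diag⟩
      ((hrtop _).trans (UBP.top_mul c.1 _ hcb).symm))⟩
  choose σ hσ using hex
  refine ⟨σ, fun c => ⟨(hσ c).symm, fun g hg => ?_⟩, ?_⟩
  · exact (r (t c)).mulRight_injective (LClass.ext (hg.symm.trans (hσ c).symm))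
  refine (character_inducedRep (groupIrrep π lam) r (fun l => ?_) d).trans ?_
  · refine ⟨⟨_, l.setPartitionType_top⟩, hrtop _, fun γ hγ => Subtype.ext ?_⟩
    exact (hrtop γ).symm.trans hγ
  -- The sum over all orbits reduces to the image of `t`: the diagonal block vanishes at any orbit
  -- that comes from no coarsening.
  refine (Fintype.sum_of_injective t ?_ _ _ ?_ ?_).symm
  · intro c c' h
    have h' : c.1.top = c'.1.top := congrArg Subtype.val h
    rw [c.2.2.1, c'.2.2.1] at h'
    -- Both coarsenings equal `d * e γ` for their common row `γ`.
    exact Subtype.ext (by rw [← UBP.mul_e_bot_of_le c.2.1, ← UBP.mul_e_bot_of_le c'.2.1, h'])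
  · intro γ hγ
    rw [inducedProj_comp_incl_of_ne, map_zero]
    intro g hg
    obtain ⟨c, hc, htop, hbot⟩ := LClass.exists_coarsening hg
    have hctop := htop.trans (hrtop γ)
    exact hγ ⟨⟨c, hc, htop.trans hbot.symm, by rw [hctop, γ.2, hπt]⟩, Subtype.ext hctop⟩
  · intro c
    rw [inducedProj_comp_incl_of_eq _ ((hsmul c).trans (hσ c).symm)]
    rfl
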